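/- **Setting.** Let $B_p(0,1)\subset\mathbb R^n$ be the closed unit ball of the $L^p$ norm. An *$\varepsilon$-minimum* of $f:B_p(0,1)\to\mathbb R$ is a point $x\in B_p(0,1)$ with $f(x)<\min f+\varepsilon$. An oracle for a family $\mathcal F$ of functions on $B_p(0,1)$ is *first-order* if it answers a query $x\in B_p(0,1)$ about $f\in\mathcal F$ with $f(x)$ and a subgradient of $f$ at $x$; it is *single-coordinate* if moreover this subgradient is of the form $\lambda e_i$, where $i$ is the smallest index such that some multiple of $e_i$ is a subgradient of $f$ at $x$; it is *local* if any two $f,g\in\mathcal F$ that agree in a neighbourhood of $x$ receive the same answer at $x$. An algorithm accesses an unknown $f\in\mathcal F$, drawn uniformly at random from the finite family $\mathcal F$, only through adaptive queries to the oracle; it may use private randomness, and stops after a number $T\in\{0,1,2,\dots\}\cup\{\infty\}$ of queries, returning a point of $B_p(0,1)$ if $T<\infty$. It has *error probability at most $P_e$* if it returns an $\varepsilon$-minimum of $f$ with probability at least $1-P_e$, over $f$ and the private randomness; $P_e=0$ is the error-free case. $\log$ is the binary logarithm. **Proposition 5.4.** For every $\delta>0$ there are constants $c,K>0$ and a function $\eta:\mathbb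 R\to\mathbb R$ with $\eta(t)\to0$ as $t\to\infty$, all depending only on $\delta$, such that for all $1\le p<\infty$, all integers $n\ge1$ and all $0<\varepsilon\le n^{-1/p-\delta}$ the following holds. There are a finite non-empty family $\mathcal F$ of convex functions on $B_p(0,1)$ that are Lipschitz continuous in the $L^p$ norm with constant $1$, and a single-coordinate local oracle for $\mathcal F$, such that for every $P_e\in[0,1)$: 1. (distributional complexity) if $(1-P_e)\,n\log\frac1\varepsilon\ge K$, then the infimum of $\mathbb E[T]$ over all algorithms with error probability at most $P_e$ is at least $c\,(1-P_e)\,n\log\frac1\varepsilon$; 2. (high-probability complexity) for every algorithm with error probability at most $P_e$, $$\sup\Big\{\tau : \mathbb P[T\ge\tau]\ge 1-P_e-\eta\big(n\log\tfrac1\varepsilon\big)\Big\}\ \ge\ c\,n\log\tfrac1\varepsilon .$$ That is, for finding an $\varepsilon$-minimum under the uniform distribution, the distributional complexity is $\Omega\big((1-P_e)\,n\log\frac1\varepsilon\big)$ and the high-probability complexity is $\Omega\big(n\log\frac1\varepsilon\big)$; for error-free algorithms both are $\Omega\big(n\log\frac1\varepsilon\big)$. -/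

import Mathlib

open MeasureTheory Filter Topology
open scoped ENNReal

/-! ### Query algorithms -/

/-- A deterministic algorithm with queries in `Q`, oracle answers in `R` and outputs in `O`.
From the list of answers received so far (oldest first) it either asks a further query (`Sum.inl`)
or stops and returns an output (`Sum.inr`). -/
abbrev Algorithm (Q R O : Type) : Type := List R → Q ⊕ O

namespace Algorithm

variable {Q R O : Type}

/-- The list of answers received in the first `t` rounds, when queries are answered by `ans`
(nothing is added any more once the algorithm has stopped). -/
def answers (A : Algorithm Q R O) (ans : Q → R) : ℕ → List R
  | 0 => []
  | t + 1 =>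
    match A (answers A ans t) with
    | Sum.inl q => answers A ans t ++ [ans q]
    | Sum.inr _ => answers A ans t

/-- The number `T` of queries asked before the algorithm stops (`⊤` if it never stops). -/
noncomputable def queryCount (A : Algorithm Q R O) (ans : Q → R) : ℕ∞ :=
  ⨅ (t : ℕ) (_ : (A (A.answers ans t)).isRight), (t : ℕ∞)

/-- The algorithm stops and returns `o`. -/
def Returns (A : Algorithm Q R O) (ans : Q → R) (o : O) : Prop :=
  ∃ t : ℕ, A (A.answers ans t) = Sum.inr o

end Algorithm

/-- A randomized algorithm for the finite family of instances `F` with oracle `orc`, where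
`good f o` says that `o` is a correct output for the instance `f`: a random deterministic algorithm,
for which the number of queries is a random variable and success is an event, on every instance. -/
structure RandomizedAlgorithm {I Q R O : Type} (F : Finset I) (orc : I → Q → R)
    (good : I → O → Prop) : Type 1 where
  /-- the sample space of the private randomness -/
  Ω : Type
  /-- its events -/
  mΩ : MeasurableSpace Ω
  /-- its probability -/
  μ : Measure Ω
  isProb : IsProbabilityMeasure μ
  /-- the deterministic algorithm run for a given outcome of the private randomness -/
  alg : Ω → Algorithm Q R O
  measurable_queryCount : ∀ f ∈ F, Measurable fun ω => ((alg ω).queryCount (orc f) : ℝ≥0∞)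
  measurableSet_success :
    ∀ f ∈ F, MeasurableSet {ω | ∃ o, (alg ω).Returns (orc f) o ∧ good f o}

namespace RandomizedAlgorithm

variable {I Q R O : Type} {F : Finset I} {orc : I → Q → R} {good : I → O → Prop}

/-- The probability that a correct output is returned, for a uniformly random instance of `F`
(independent of the private randomness). -/
noncomputable def successProb (A : RandomizedAlgorithm F orc good) : ℝ≥0∞ :=
  (∑ f ∈ F, A.μ {ω | ∃ o, (A.alg ω).Returns (orc f) o ∧ good f o}) / (F.card : ℝ≥0∞)

/-- The expected number of queries `𝔼[T]`, for a uniformly random instance of `F`. -/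
noncomputable def expectedQueries (A : RandomizedAlgorithm F orc good) : ℝ≥0∞ :=
  letI := A.mΩ
  (∑ f ∈ F, ∫⁻ ω, ((A.alg ω).queryCount (orc f) : ℝ≥0∞) ∂A.μ) / (F.card : ℝ≥0∞)

/-- The probability `ℙ[T ≥ τ]`, for a uniformly random instance of `F`. -/
noncomputable def tailProb (A : RandomizedAlgorithm F orc good) (τ : ℝ≥0∞) : ℝ≥0∞ :=
  (∑ f ∈ F, A.μ {ω | τ ≤ ((A.alg ω).queryCount (orc f) : ℝ≥0∞)}) / (F.card : ℝ≥0∞)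

end RandomizedAlgorithm

/-- Distributional complexity under the uniform distribution on `F`, for algorithms with error
probability at most `Pe`: the infimum of the expected number of queries. -/
noncomputable def distributionalComplexity {I Q R O : Type} (F : Finset I) (orc : I → Q → R)
    (good : I → O → Prop) (Pe : ℝ) : ℝ≥0∞ :=
  ⨅ (A : RandomizedAlgorithm F orc good) (_ : ENNReal.ofReal (1 - Pe) ≤ A.successProb),
    A.expectedQueries

/-- High-probability complexity under the uniform distribution on `F`, for algorithms with error
probability at most `Pe`, at slack `η`: the infimum over these algorithms of the largest `τ` with
`ℙ[T ≥ τ] ≥ 1 - Pe - η`. -/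
noncomputable def highProbabilityComplexity {I Q R O : Type} (F : Finset I) (orc : I → Q → R)
    (good : I → O → Prop) (Pe η : ℝ) : ℝ≥0∞ :=
  ⨅ (A : RandomizedAlgorithm F orc good) (_ : ENNReal.ofReal (1 - Pe) ≤ A.successProb),
    sSup {τ : ℝ≥0∞ | ENNReal.ofReal (1 - Pe - η) ≤ A.tailProb τ}

/-! ### Convex functions on the `L^p`-ball and their oracles -/

/-- The closed unit ball of `ℝⁿ` with the `L^p` norm (with the metric of that norm). -/
abbrev LpBall (p : ℝ≥0∞) [Fact (1 ≤ p)] (n : ℕ) : Type :=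
  ↥(Metric.closedBall (0 : PiLp p (fun _ : Fin n => ℝ)) 1)

namespace LpBall

variable {p : ℝ≥0∞} [Fact (1 ≤ p)] {n : ℕ}

/-- Convexity of a function on the ball. -/
def IsConvex (f : LpBall p n → ℝ) : Prop :=
  ∀ (x y z : LpBall p n) (a b : ℝ), 0 ≤ a → 0 ≤ b → a + b = 1 →
    z.1 = a • x.1 + b • y.1 → f z ≤ a * f x + b * f y

/-- `x` is an `ε`-minimum of `f`. -/
def IsEpsMin (ε : ℝ) (f : LpBall p n → ℝ) (x : LpBall p n) : Prop :=
  f x < (⨅ y, f y) + ε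

/-- `g` is a subgradient at `x` of the function `f` on the ball. -/
def IsSubgradient (f : LpBall p n → ℝ) (x : LpBall p n) (g : Fin n → ℝ) : Prop :=
  ∀ y : LpBall p n, f x + ∑ i, g i * (y.1 i - x.1 i) ≤ f y

/-- An oracle assigns to an instance `f` and a query `x` a real number and a vector. -/
abbrev Oracle (p : ℝ≥0∞) [Fact (1 ≤ p)] (n : ℕ) : Type :=
  (LpBall p n → ℝ) → LpBall p n → ℝ × (Fin n → ℝ)

/-- The oracle answers with the function value and a subgradient. -/
def Oracle.IsFirstOrder (orc : Oracle p n) (F : Finset (LpBall p n → ℝ)) : Prop :=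
  ∀ f ∈ F, ∀ x, (orc f x).1 = f x ∧ IsSubgradient f x (orc f x).2

/-- Instances that agree in a neighbourhood of the query get the same answer. -/
def Oracle.IsLocal (orc : Oracle p n) (F : Finset (LpBall p n → ℝ)) : Prop :=
  ∀ f ∈ F, ∀ g ∈ F, ∀ x, f =ᶠ[𝓝 x] g → orc f x = orc g x

/-- A first-order oracle is single-coordinate if the subgradient in its answer is supported on one
coordinate axis, the least one that supports a subgradient at the query. -/
def Oracle.IsSingleCoordinate (orc : Oracle p n) (F : Finset (LpBall p n → ℝ)) : Prop :=
  orc.IsFirstOrder F ∧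
    ∀ f ∈ F, ∀ x, ∃ (i : Fin n) (s : ℝ), (orc f x).2 = Pi.single i s ∧
      ∀ (j : Fin n) (t : ℝ), IsSubgradient f x (Pi.single j t) → i ≤ j

end LpBall

/-! The hard functions are indexed by strings of `n * M` bits, with `M` of order `log (1/ε)` bits
for each coordinate. Every coordinate carries a function `BinaryTree.fn`, whose bits steer its
minimizer down a binary tree, and `treeMax` is the maximum over the coordinates, rescaled by `ρ =
n^(1/p)` so that the unit cube fits into the ball. An ε-minimum determines the string
(`eq_of_isEpsMin`), so minimizing means learning all the bits.

A query point amounts to a guess of the string: the tree paths to its coordinates. After a wrong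
turn the later bits of that coordinate are invisible near the point, and a single-coordinate answer
describes only the leading coordinate. Hence the answer depends only on the first mismatch between
string and guess, in an order fixed by the query (`exists_isLeading_of_isFirstMismatch`,
`axisOracle_treeMax_eq`).

A lucky query may confirm many bits, but for few strings: by `Algorithm.card_solved_le`, `N`
adaptive queries solve at most `2^N * (3/2)^(n*M)` of the `2^(n*M)` strings, a vanishing fraction
while `N` is at most a small multiple of `n * M`. Averaging over the private randomness
(`successProb_le`) bounds the tail of `T` below by the success probability minus that fraction, and
Markov's inequality gives the expectation. The bound on `ε` enters through `rpow_mul_le`: rescaling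
by `ρ` leaves a fraction `δ/(1+δ)` of the `log (1/ε)` bits of accuracy. -/

/-! ### Guessing a bit string when each query reveals the first mismatch -/

section Guessing

variable {B : Type} [Fintype B] [DecidableEq B]

/-- The strings that agree with `ρ` outside the set `E` of free positions. -/
def subcube (E : Finset B) (ρ : B → Bool) : Finset (B → Bool) :=
  Finset.univ.filter fun s => ∀ b, b ∉ E → s b = ρ b

theorem mem_subcube {E : Finset B} {ρ s : B → Bool} :
    s ∈ subcube E ρ ↔ ∀ b, b ∉ E → s b = ρ b := by
  simp [subcube]

theorem subcube_univ (ρ : B → Bool) : subcube Finset.univ ρ = Finset.univ := by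
  ext s; simp [mem_subcube]

theorem mem_subcube_erase_update {E : Finset B} {ρ s : B → Bool} {b : B} (hb : b ∈ E) (c : Bool) :
    s ∈ subcube (E.erase b) (Function.update ρ b c) ↔ s ∈ subcube E ρ ∧ s b = c := by
  simp only [mem_subcube, Finset.mem_erase, not_and]
  constructor
  · intro h
    refine ⟨fun b' hb' => ?_, ?_⟩
    · have hne : b' ≠ b := fun e => hb' (e ▸ hb)
      simpa [Function.update_of_ne hne] using h b' fun _ => hb'
    · simpa using h b fun e => absurd rfl e
  · rintro ⟨h, hc⟩ b' hb'
    by_cases e : b' = b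
    · subst e; simpa using hc
    · simpa [Function.update_of_ne e] using h b' (hb' e)

/-- In the order of the positions given by `key`, the string `s` first differs from `g` at `b`. -/
def IsFirstMismatch {X : Type} [LinearOrder X] (key : B → X) (g s : B → Bool) (b : B) : Prop :=
  s b ≠ g b ∧ ∀ b', key b' < key b → s b' = g b'

open Classical in
/-- A bound on the number of strings with a property on subcubes where an answer is constant gives
a bound, worse by a factor `2`, on all subcubes, if the answer only depends on the first mismatch
with some string. -/
theorem card_filter_subcube_le_of_isFirstMismatch {R X : Type} [LinearOrder X] {key : B → X}
    {g : B → Bool} {ans : (B → Bool) → R}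
    (hans : ∀ b s t, IsFirstMismatch key g s b → IsFirstMismatch key g t b → ans s = ans t)
    (P : (B → Bool) → Prop) {β : ℝ} (hβ : 0 ≤ β)
    (hconst : ∀ E ρ, (∀ s ∈ subcube E ρ, ∀ t ∈ subcube E ρ, ans s = ans t) →
      (((subcube E ρ).filter P).card : ℝ) ≤ β * (3 / 2) ^ E.card) (E : Finset B) (ρ : B → Bool) :
    (((subcube E ρ).filter P).card : ℝ) ≤ 2 * β * (3 / 2) ^ E.card := by
  have hconst' : ∀ E ρ, (∀ s ∈ subcube E ρ, ∀ t ∈ subcube E ρ, ans s = ans t) →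
      (((subcube E ρ).filter P).card : ℝ) ≤ 2 * β * (3 / 2) ^ E.card := fun E ρ h =>
    (hconst E ρ h).trans (by
      have : 0 ≤ β * (3 / 2) ^ E.card := by positivity
      linarith)
  -- `U` holds the positions not yet known to agree with the guess; the induction removes the
  -- earliest of them.
  have main : ∀ (m : ℕ) (U : Finset B), U.card = m → ∀ (E : Finset B) (ρ : B → Bool),
      (∀ b, b ∉ U → ∀ s ∈ subcube E ρ, s b = g b) →
      (((subcube E ρ).filter P).card : ℝ) ≤ 2 * β * (3 / 2) ^ E.card := by
    intro m
    induction m with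
    | zero =>
      intro U hU E ρ h
      refine hconst' E ρ fun s hs t ht => ?_
      have hU' : U = ∅ := Finset.card_eq_zero.mp hU
      have : s = t := by
        ext b
        rw [h b (by simp [hU']) s hs, h b (by simp [hU']) t ht]
      rw [this]
    | succ m ih =>
      intro U hU E ρ h
      obtain ⟨b, hbU, hb⟩ := Finset.exists_min_image U key
        (Finset.card_pos.mp (by omega))
      have hlt : ∀ b', key b' < key b → b' ∉ U := fun b' hb' hU' =>
        absurd (hb b' hU') (not_le.2 hb')
      have hfm : ∀ s ∈ subcube E ρ, s b ≠ g b → IsFirstMismatch key g s b := fun s hs hne =>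
        ⟨hne, fun b' hb' => h b' (hlt b' hb') s hs⟩
      have hcard : (U.erase b).card = m := by rw [Finset.card_erase_of_mem hbU, hU]; rfl
      have hstep : ∀ (E' : Finset B) (ρ' : B → Bool), (∀ s ∈ subcube E' ρ', s ∈ subcube E ρ) →
          (∀ s ∈ subcube E' ρ', s b = g b) →
          (((subcube E' ρ').filter P).card : ℝ) ≤ 2 * β * (3 / 2) ^ E'.card := by
        intro E' ρ' hsub hbg
        refine ih (U.erase b) hcard E' ρ' fun c hc s hs => ?_
        by_cases e : c = b
        · rw [e]; exact hbg s hs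
        · exact h c (fun hU' => hc (Finset.mem_erase.2 ⟨e, hU'⟩)) s (hsub s hs)
      by_cases hbE : b ∈ E
      · have hright := hstep (E.erase b) (Function.update ρ b (g b))
          (fun s hs => ((mem_subcube_erase_update hbE _).1 hs).1)
          (fun s hs => ((mem_subcube_erase_update hbE _).1 hs).2)
        -- On the half with the wrong bit every string has its first mismatch at `b`, so the answer
        -- is constant and the sharper bound applies.
        have hwrong := hconst (E.erase b) (Function.update ρ b (!g b)) (fun s hs t ht => by
          rw [mem_subcube_erase_update hbE] at hs ht
          exact hans b s t (hfm s hs.1 (by simp [hs.2])) (hfm t ht.1 (by simp [ht.2])))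
        have hsplit : (subcube E ρ).filter P ⊆
            (subcube (E.erase b) (Function.update ρ b (g b))).filter P ∪
            (subcube (E.erase b) (Function.update ρ b (!g b))).filter P := by
          intro s hs
          rw [Finset.mem_filter] at hs
          simp only [Finset.mem_union, Finset.mem_filter, mem_subcube_erase_update hbE]
          by_cases e : s b = g b
          · exact Or.inl ⟨⟨hs.1, e⟩, hs.2⟩
          · exact Or.inr ⟨⟨hs.1, by cases h1 : s b <;> cases h2 : g b <;> simp_all⟩, hs.2⟩
        have hle := (Nat.cast_le (α := ℝ)).2
          ((Finset.card_le_card hsplit).trans (Finset.card_union_le _ _))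
        push_cast at hle
        have hE : E.card = (E.erase b).card + 1 := (Finset.card_erase_add_one hbE).symm
        -- The right half contributes `2β` and the wrong half `β`, in total `3β = 2β * (3/2)`: this
        -- is where the base `3/2 < 2` comes from.
        rw [hE, pow_succ]
        linarith
      · by_cases e : ρ b = g b
        · exact hstep E ρ (fun _ hs => hs) fun s hs => (mem_subcube.1 hs b hbE).trans e
        · refine hconst' E ρ fun s hs t ht => hans b s t (hfm s hs ?_) (hfm t ht ?_)
          · rwa [mem_subcube.1 hs b hbE]
          · rwa [mem_subcube.1 ht b hbE]
  exact main _ Finset.univ rfl E ρ fun b hb => absurd (Finset.mem_univ b) hb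

end Guessing

/-! ### Runs of a deterministic algorithm and the number of strings it solves -/

namespace Algorithm

variable {Q R O : Type}

/-- The algorithm that is left after the answer `r` to the first query. -/
def afterAnswer (A : Algorithm Q R O) (r : R) : Algorithm Q R O := fun l => A (r :: l)

theorem answers_of_nil_eq_inr {A : Algorithm Q R O} {o : O} (h : A [] = Sum.inr o) (ans : Q → R)
    (t : ℕ) : A.answers ans t = [] := by
  induction t with
  | zero => rfl
  | succ t ih => simp [answers, ih, h]

theorem answers_succ_of_nil_eq_inl {A : Algorithm Q R O} {q : Q} (h : A [] = Sum.inl q)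
    (ans : Q → R) (t : ℕ) :
    A.answers ans (t + 1) = ans q :: (A.afterAnswer (ans q)).answers ans t := by
  induction t with
  | zero => simp [answers, h]
  | succ t ih =>
    rw [answers, ih, answers, show (A.afterAnswer (ans q)) ((A.afterAnswer (ans q)).answers ans t)
      = A (ans q :: (A.afterAnswer (ans q)).answers ans t) from rfl]
    cases A (ans q :: (A.afterAnswer (ans q)).answers ans t) <;> simp

theorem answers_of_stopped {A : Algorithm Q R O} {ans : Q → R} {t : ℕ} {o : O}
    (h : A (A.answers ans t) = Sum.inr o) {u : ℕ} (htu : t ≤ u) :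
    A.answers ans u = A.answers ans t := by
  induction u, htu using Nat.le_induction with
  | base => rfl
  | succ u _ ih => simp [answers, ih, h]

/-- After stopping, the list of answers is frozen, so a run with at most `N` queries shows its
output at round `N` exactly. -/
theorem apply_answers_of_returns {A : Algorithm Q R O} {ans : Q → R} {o : O}
    (h : A.Returns ans o) {N : ℕ} (hN : A.queryCount ans < (N + 1 : ℕ)) :
    A (A.answers ans N) = Sum.inr o := by
  obtain ⟨t, ht⟩ := h
  have : ∃ u, (A (A.answers ans u)).isRight ∧ u < N + 1 := by
    simp only [queryCount, iInf_lt_iff] at hN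
    obtain ⟨u, hu, huN⟩ := hN
    exact ⟨u, hu, by exact_mod_cast huN⟩
  obtain ⟨u, hu, huN⟩ := this
  obtain ⟨o', ho'⟩ := Sum.isRight_iff.1 hu
  have e1 : A (A.answers ans N) = Sum.inr o' := by
    rw [answers_of_stopped ho' (Nat.lt_succ_iff.1 huN), ho']
  rcases le_total t N with h | h
  · rw [answers_of_stopped ht h, ht]
  · rw [← ht, answers_of_stopped e1 h]

open Classical in
/-- If every query reveals only the first mismatch of the hidden string with a guess, in an order
that may depend on the query, then few strings are found with few queries. -/
theorem card_solved_le {B : Type} [Fintype B] [DecidableEq B] {X : Type} [LinearOrder X]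
    {key : Q → B → X} {g : Q → B → Bool}
    {ans : (B → Bool) → Q → R}
    (hans : ∀ q b s t, IsFirstMismatch (key q) (g q) s b → IsFirstMismatch (key q) (g q) t b →
      ans s q = ans t q)
    {good : (B → Bool) → O → Prop} (hgood : ∀ s t o, good s o → good t o → s = t)
    (A : Algorithm Q R O) (N : ℕ) (E : Finset B) (ρ : B → Bool) :
    (((subcube E ρ).filter fun s =>
      ∃ o, A (A.answers (ans s) N) = Sum.inr o ∧ good s o).card : ℝ) ≤
      2 ^ N * (3 / 2) ^ E.card := by
  -- With no answers received, all strings get the same output, which is correct for at most one of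
  -- them.
  have hnil : ∀ (A : Algorithm Q R O) (N : ℕ) (E : Finset B) (ρ : B → Bool),
      (∀ s, A.answers (ans s) N = []) →
      (((subcube E ρ).filter fun s =>
        ∃ o, A (A.answers (ans s) N) = Sum.inr o ∧ good s o).card : ℝ) ≤
        2 ^ N * (3 / 2) ^ E.card := by
    intro A N E ρ h
    refine le_trans ?_ (one_le_mul_of_one_le_of_one_le (one_le_pow₀ (by norm_num))
      (one_le_pow₀ (by norm_num)))
    rw [Nat.cast_le_one, Finset.card_le_one]
    intro s hs t ht
    obtain ⟨-, o, ho, hso⟩ := Finset.mem_filter.1 hs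
    obtain ⟨-, o', ho', hto⟩ := Finset.mem_filter.1 ht
    rw [h] at ho ho'
    rw [ho] at ho'
    exact hgood s t o hso (Sum.inr.inj ho' ▸ hto)
  induction N generalizing A E ρ with
  | zero => exact hnil A 0 E ρ fun _ => rfl
  | succ N ih =>
    rcases hA : A [] with q | o
    · rw [pow_succ, mul_comm ((2 : ℝ) ^ N)]
      refine card_filter_subcube_le_of_isFirstMismatch (hans q) _ (by positivity)
        (fun E ρ hc => ?_) E ρ
      rcases (subcube E ρ).eq_empty_or_nonempty with h0 | ⟨s₀, hs₀⟩
      · rw [h0]; simp only [Finset.filter_empty, Finset.card_empty, Nat.cast_zero]; positivity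
      -- A constant answer leaves the same residual algorithm for all strings of the subcube.
      · refine le_trans (le_of_eq ?_) (ih (A.afterAnswer (ans s₀ q)) E ρ)
        congr 2
        refine Finset.filter_congr fun s hs => ?_
        rw [answers_succ_of_nil_eq_inl hA, hc s hs s₀ hs₀]
        rfl
    · exact hnil A _ E ρ fun s => answers_of_nil_eq_inr hA _ _

end Algorithm

/-! ### A binary tree of convex functions on the line -/

namespace BinaryTree

/-- The sign that a bit stands for. -/
def sgn (c : Bool) : ℝ := if c then 1 else -1

theorem abs_sgn (c : Bool) : |sgn c| = 1 := by cases c <;> simp [sgn]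

/-- The convex functions on the line that are indexed by the leaves of a binary tree: each bit of
the string moves the minimizer to the left or to the right. -/
noncomputable def fn : (M : ℕ) → (Fin M → Bool) → ℝ → ℝ
  | 0, _, x => |x|
  | M + 1, b, x => max |x| (3 / 16 + fn M (Fin.tail b) (8 * x - sgn (b 0)) / 16)

/-- The minimum of the functions `fn M b`. -/
noncomputable def minVal : ℕ → ℝ
  | 0 => 0
  | M + 1 => 3 / 16 + minVal M / 16

/-- The minimizer of `fn M b`. -/
noncomputable def argmin : (M : ℕ) → (Fin M → Bool) → ℝ
  | 0, _ => 0
  | M + 1, b => (sgn (b 0) + argmin M (Fin.tail b)) / 8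

/-- The path in the tree that leads to a point. -/
noncomputable def path : (M : ℕ) → ℝ → Fin M → Bool
  | 0, _ => Fin.elim0
  | M + 1, x => Fin.cons (decide (0 ≤ x)) (path M (8 * x - sgn (decide (0 ≤ x))))

theorem abs_le_fn (M : ℕ) (b : Fin M → Bool) (x : ℝ) : |x| ≤ fn M b x := by
  cases M with
  | zero => exact le_rfl
  | succ M => exact le_max_left _ _

/-- `1/5` is the fixed point of `v ↦ 3/16 + v/16`. -/
theorem minVal_le (M : ℕ) : minVal M ≤ 1 / 5 := by
  induction M with
  | zero => norm_num [minVal]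
  | succ M ih => simp only [minVal]; linarith

/-- One recursion step turns the bound into at most `|x|/2 + 1/4`, which is again below `max |x|
(1/2)`. Thus the bits have no influence where `1/2 ≤ |x|`. -/
theorem fn_le (M : ℕ) (b : Fin M → Bool) (x : ℝ) : fn M b x ≤ max |x| (1 / 2) := by
  induction M generalizing x with
  | zero => exact le_max_left _ _
  | succ M ih =>
    refine max_le (le_max_left _ _) ?_
    have h1 := ih (Fin.tail b) (8 * x - sgn (b 0))
    have h2 : |8 * x - sgn (b 0)| ≤ 8 * |x| + 1 := by
      calc _ ≤ |8 * x| + |sgn (b 0)| := abs_sub _ _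
        _ = _ := by rw [abs_sgn, abs_mul]; norm_num
    rcases max_cases |x| (1 / 2 : ℝ) with h | h <;>
    rcases max_cases |8 * x - sgn (b 0)| (1 / 2 : ℝ) with h' | h' <;> linarith

theorem fn_eq_abs (M : ℕ) (b : Fin M → Bool) {x : ℝ} (hx : 1 / 2 ≤ |x|) : fn M b x = |x| :=
  le_antisymm ((fn_le M b x).trans (max_le le_rfl hx)) (abs_le_fn M b x)

theorem abs_fn_sub_le (M : ℕ) (b : Fin M → Bool) (x y : ℝ) : |fn M b x - fn M b y| ≤ |x - y| := by
  induction M generalizing x y with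
  | zero => exact abs_abs_sub_abs_le _ _
  | succ M ih =>
    refine (abs_max_sub_max_le_max _ _ _ _).trans (max_le (abs_abs_sub_abs_le _ _) ?_)
    have h := ih (Fin.tail b) (8 * x - sgn (b 0)) (8 * y - sgn (b 0))
    have e : 8 * x - sgn (b 0) - (8 * y - sgn (b 0)) = 8 * (x - y) := by ring
    rw [e, abs_mul, abs_of_pos (by norm_num : (0 : ℝ) < 8)] at h
    rw [show ∀ u v : ℝ, 3 / 16 + u / 16 - (3 / 16 + v / 16) = (u - v) / 16 from fun u v => by ring,
      abs_div, abs_of_pos (by norm_num : (0 : ℝ) < 16)]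
    have := abs_nonneg (x - y)
    linarith

theorem fn_convex (M : ℕ) (b : Fin M → Bool) {x y α β : ℝ} (hα : 0 ≤ α) (hβ : 0 ≤ β)
    (h : α + β = 1) : fn M b (α * x + β * y) ≤ α * fn M b x + β * fn M b y := by
  have habs : |α * x + β * y| ≤ α * |x| + β * |y| := by
    refine (abs_add_le _ _).trans ?_
    rw [abs_mul, abs_mul, abs_of_nonneg hα, abs_of_nonneg hβ]
  induction M generalizing x y with
  | zero => exact habs
  | succ M ih =>
    refine max_le (habs.trans (by gcongr <;> exact abs_le_fn _ _ _)) ?_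
    have h1 := ih (Fin.tail b) (x := 8 * x - sgn (b 0)) (y := 8 * y - sgn (b 0)) (by
      refine (abs_add_le _ _).trans ?_
      rw [abs_mul, abs_mul, abs_of_nonneg hα, abs_of_nonneg hβ])
    have e : α * (8 * x - sgn (b 0)) + β * (8 * y - sgn (b 0)) =
        8 * (α * x + β * y) - sgn (b 0) := by
      linear_combination (-sgn (b 0)) * h
    rw [e] at h1
    have h2 : α * (3 / 16 + fn M (Fin.tail b) (8 * x - sgn (b 0)) / 16) ≤ α * fn (M + 1) b x := by
      gcongr; exact le_max_right _ _
    have h3 : β * (3 / 16 + fn M (Fin.tail b) (8 * y - sgn (b 0)) / 16) ≤ β * fn (M + 1) b y := by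
      gcongr; exact le_max_right _ _
    linarith

theorem exists_subgradient_fn (M : ℕ) (b : Fin M → Bool) (x : ℝ) :
    ∃ l, ∀ y, fn M b x + l * (y - x) ≤ fn M b y := by
  have habs : ∃ l : ℝ, ∀ y, |x| + l * (y - x) ≤ |y| := by
    rcases le_total 0 x with h | h
    · exact ⟨1, fun y => by rw [abs_of_nonneg h]; linarith [le_abs_self y]⟩
    · exact ⟨-1, fun y => by rw [abs_of_nonpos h]; linarith [neg_le_abs y]⟩
  induction M generalizing x with
  | zero => exact habs
  | succ M ih =>
    rcases max_cases |x| (3 / 16 + fn M (Fin.tail b) (8 * x - sgn (b 0)) / 16) with h | h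
    · obtain ⟨l, hl⟩ := habs
      refine ⟨l, fun y => ?_⟩
      rw [fn, h.1]
      exact (hl y).trans (abs_le_fn _ _ _)
    · obtain ⟨l, hl⟩ := ih (Fin.tail b) (8 * x - sgn (b 0)) (by
        rcases le_total 0 (8 * x - sgn (b 0)) with h | h
        · exact ⟨1, fun y => by rw [abs_of_nonneg h]; linarith [le_abs_self y]⟩
        · exact ⟨-1, fun y => by rw [abs_of_nonpos h]; linarith [neg_le_abs y]⟩)
      refine ⟨l / 2, fun y => ?_⟩
      rw [fn, h.1]
      refine le_trans ?_ (le_max_right _ _)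
      have := hl (8 * y - sgn (b 0))
      linarith

theorem minVal_le_fn (M : ℕ) (b : Fin M → Bool) (x : ℝ) : minVal M ≤ fn M b x := by
  induction M generalizing x with
  | zero => exact abs_nonneg x
  | succ M ih =>
    refine le_trans ?_ (le_max_right _ _)
    have := ih (Fin.tail b) (8 * x - sgn (b 0))
    simp only [minVal]
    linarith

/-- The two claims are proved together: the bound on the minimizer keeps the term `|x|` from winning
the maximum there. -/
theorem abs_argmin_le_and_fn_argmin (M : ℕ) (b : Fin M → Bool) :
    |argmin M b| ≤ minVal M ∧ fn M b (argmin M b) = minVal M := by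
  induction M with
  | zero => simp [argmin, minVal, fn]
  | succ M ih =>
    obtain ⟨h1, h2⟩ := ih (Fin.tail b)
    have h3 : |argmin (M + 1) b| ≤ minVal (M + 1) := by
      simp only [argmin, minVal, abs_div, abs_of_pos (by norm_num : (0 : ℝ) < 8)]
      have h4 := abs_add_le (sgn (b 0)) (argmin M (Fin.tail b))
      rw [abs_sgn] at h4
      have := minVal_le M
      linarith
    refine ⟨h3, ?_⟩
    have e : 8 * argmin (M + 1) b - sgn (b 0) = argmin M (Fin.tail b) := by
      simp only [argmin]; ring
    rw [fn, e, h2]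
    exact max_eq_right h3

theorem abs_argmin_le (M : ℕ) (b : Fin M → Bool) : |argmin M b| ≤ minVal M :=
  (abs_argmin_le_and_fn_argmin M b).1

theorem fn_argmin (M : ℕ) (b : Fin M → Bool) : fn M b (argmin M b) = minVal M :=
  (abs_argmin_le_and_fn_argmin M b).2

/-- Approximate minimizers determine the string. -/
theorem eq_of_fn_lt (M : ℕ) {ε x : ℝ} (hε : ε ≤ (1 / 16) ^ M / 2) {b b' : Fin M → Bool}
    (h : fn M b x < minVal M + ε) (h' : fn M b' x < minVal M + ε) : b = b' := by
  induction M generalizing ε x with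
  | zero => exact Subsingleton.elim _ _
  | succ M ih =>
    have key : ∀ c : Fin (M + 1) → Bool, fn (M + 1) c x < minVal (M + 1) + ε →
        fn M (Fin.tail c) (8 * x - sgn (c 0)) < minVal M + 16 * ε := by
      intro c hc
      have := (le_max_right _ _).trans_lt hc
      simp only [minVal] at this
      linarith
    have hε' : 16 * ε ≤ (1 / 16) ^ M / 2 := by rw [pow_succ] at hε; linarith
    have h1 : ((1 : ℝ) / 16) ^ M ≤ 1 := pow_le_one₀ (by norm_num) (by norm_num)
    -- Since `minVal M + 16 * ε ≤ 1/5 + 1/2 < 1`, the point `8 * x` is within distance `1` of `sgn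
    -- (c 0)`, so the sign of `x` is the first bit.
    have h2 : ∀ c : Fin (M + 1) → Bool, fn (M + 1) c x < minVal (M + 1) + ε →
        |8 * x - sgn (c 0)| < 1 := by
      intro c hc
      have := (abs_le_fn _ _ _).trans_lt (key c hc)
      have := minVal_le M
      linarith
    have h0 : b 0 = b' 0 := by
      have hb := abs_lt.1 (h2 b h)
      have hb' := abs_lt.1 (h2 b' h')
      cases e : b 0 <;> cases e' : b' 0 <;> simp only [e, e', sgn] at hb hb' ⊢ <;>
        norm_num at hb hb' <;> linarith
    have ht : Fin.tail b = Fin.tail b' := by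
      refine ih hε' (key b h) ?_
      rw [h0]
      exact key b' h'
    rw [← Fin.cons_self_tail b, ← Fin.cons_self_tail b', h0, ht]

/-- A wrong turn pushes the rescaled point away from the origin, to distance at least `1`, where
`fn_eq_abs` hides all later bits. -/
theorem abs_sub_sgn_of_ne {x : ℝ} {c : Bool} (hc : c ≠ decide (0 ≤ x)) :
    |8 * x - sgn c| = 8 * |x| + 1 := by
  by_cases h : 0 ≤ x
  · have : c = false := by simpa [h] using hc
    subst this
    simp only [sgn, abs_of_nonneg h]
    norm_num
    linarith
  · have : c = true := by simpa [h] using hc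
    subst this
    push Not at h
    simp only [sgn, abs_of_neg h]
    norm_num
    rw [abs_of_neg (by linarith)]
    ring

/-- Near a point, the function only depends on the first place where its string leaves the path to
the point. -/
theorem fn_eventuallyEq (M : ℕ) {x : ℝ} {b b' : Fin M → Bool} {k : Fin M}
    (h : ∀ j < k, b j = path M x j) (h' : ∀ j < k, b' j = path M x j)
    (hk : b k ≠ path M x k) (hk' : b' k ≠ path M x k) : fn M b =ᶠ[𝓝 x] fn M b' := by
  induction M generalizing x with
  | zero => exact k.elim0
  | succ M ih =>
    have hc : ∀ c : Bool, Continuous fun y : ℝ => 8 * y - sgn c := fun c => by fun_prop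
    rcases Fin.eq_zero_or_eq_succ k with rfl | ⟨k, rfl⟩
    · simp only [path, Fin.cons_zero] at hk hk'
      have h0 : b 0 = b' 0 := by
        rw [← Bool.eq_not] at hk hk'; rw [hk, hk']
      have h1 : ∀ᶠ y in 𝓝 x, 1 / 2 < |8 * y - sgn (b 0)| := by
        refine (hc (b 0)).abs.continuousAt.eventually_const_lt ?_
        have h2 := abs_sub_sgn_of_ne hk
        have := abs_nonneg x
        simp only [h2]
        linarith
      filter_upwards [h1] with y hy
      rw [fn, fn, fn_eq_abs _ _ hy.le, ← h0, fn_eq_abs _ _ hy.le]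
    · have h0 := h 0 (Fin.succ_pos k)
      have h0' := h' 0 (Fin.succ_pos k)
      simp only [path, Fin.cons_zero] at h0 h0'
      have := ih (x := 8 * x - sgn (b 0)) (b := Fin.tail b) (b' := Fin.tail b') (k := k)
        (fun j hj => by rw [h0]; simpa [path, Fin.tail] using h j.succ (Fin.succ_lt_succ_iff.2 hj))
        (fun j hj => by rw [h0]; simpa [path, Fin.tail] using h' j.succ (Fin.succ_lt_succ_iff.2 hj))
        (by rw [h0]; simpa [path, Fin.tail] using hk) (by rw [h0]; simpa [path, Fin.tail] using hk')
      filter_upwards [(hc (b 0)).continuousAt.eventually this] with y hy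
      rw [fn, fn, hy, h0, h0']

/-- The function is the larger the earlier its string leaves the path to the point. -/
theorem fn_le_fn (M : ℕ) {x : ℝ} {b b' : Fin M → Bool} {k : Fin M}
    (h : ∀ j < k, b j = path M x j) (hk : b k ≠ path M x k)
    (h' : ∀ j ≤ k, b' j = path M x j) : fn M b' x ≤ fn M b x := by
  induction M generalizing x with
  | zero => exact k.elim0
  | succ M ih =>
    refine max_le_max le_rfl ?_
    have h0' := h' 0 (Fin.zero_le k)
    rcases Fin.eq_zero_or_eq_succ k with rfl | ⟨k, rfl⟩
    · simp only [path, Fin.cons_zero] at hk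
      have h1 := abs_sub_sgn_of_ne hk
      have h2 := abs_le_fn M (Fin.tail b) (8 * x - sgn (b 0))
      have h3 := fn_le M (Fin.tail b') (8 * x - sgn (b' 0))
      have h4 : |8 * x - sgn (b' 0)| ≤ 8 * |x| + 1 := by
        calc _ ≤ |8 * x| + |sgn (b' 0)| := abs_sub _ _
          _ = _ := by rw [abs_sgn, abs_mul]; norm_num
      -- The string that turns wrong attains `8 * |x| + 1`, the upper bound for every string.
      have := max_le h4 (show (1 : ℝ) / 2 ≤ 8 * |x| + 1 by linarith [abs_nonneg x])
      linarith
    · have h0 := h 0 (Fin.succ_pos k)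
      simp only [path, Fin.cons_zero] at h0 h0'
      have := ih (x := 8 * x - sgn (b 0)) (b := Fin.tail b) (b' := Fin.tail b') (k := k)
        (fun j hj => by rw [h0]; simpa [path, Fin.tail] using h j.succ (Fin.succ_lt_succ_iff.2 hj))
        (by rw [h0]; simpa [path, Fin.tail] using hk)
        (fun j hj => by rw [h0]; simpa [path, Fin.tail] using h' j.succ (Fin.succ_le_succ_iff.2 hj))
      rw [h0', ← h0]
      linarith

end BinaryTree

/-! ### An oracle that answers with a single-coordinate subgradient -/

namespace LpBall

variable {p : ℝ≥0∞} [Fact (1 ≤ p)] {n : ℕ}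

/-- `g` is an element of `S` on a coordinate axis, the least axis that contains elements of `S`. -/
def IsLeastSingle (S : Set (Fin n → ℝ)) (g : Fin n → ℝ) : Prop :=
  g ∈ S ∧ ∃ (i : Fin n) (s : ℝ), g = Pi.single i s ∧
    ∀ (j : Fin n) (t : ℝ), Pi.single j t ∈ S → i ≤ j

theorem exists_isLeastSingle {S : Set (Fin n → ℝ)} {i : Fin n} {s : ℝ} (h : Pi.single i s ∈ S) :
    ∃ g, IsLeastSingle S g := by
  classical
  let J : Finset (Fin n) := Finset.univ.filter fun i => ∃ t : ℝ, Pi.single i t ∈ S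
  have hJ : J.Nonempty := ⟨i, by simpa [J] using ⟨s, h⟩⟩
  obtain ⟨t, ht⟩ := (Finset.mem_filter.1 (J.min'_mem hJ)).2
  exact ⟨_, ht, _, t, rfl, fun j u hu => J.min'_le j (by simpa [J] using ⟨u, hu⟩)⟩

/-- The oracle that answers with a single-coordinate subgradient chosen according to the set of
subgradients. -/
noncomputable def axisOracle (p : ℝ≥0∞) [Fact (1 ≤ p)] (n : ℕ) : Oracle p n := fun f x =>
  (f x, Classical.epsilon (IsLeastSingle {g | IsSubgradient f x g}))

theorem axisOracle_isSingleCoordinate {F : Finset (LpBall p n → ℝ)}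
    (h : ∀ f ∈ F, ∀ x, ∃ (i : Fin n) (s : ℝ), IsSubgradient f x (Pi.single i s)) :
    (axisOracle p n).IsSingleCoordinate F := by
  have key : ∀ f ∈ F, ∀ x, IsLeastSingle {g | IsSubgradient f x g} (axisOracle p n f x).2 := by
    intro f hf x
    obtain ⟨i, s, hs⟩ := h f hf x
    exact Classical.epsilon_spec (exists_isLeastSingle (S := {g | IsSubgradient f x g}) hs)
  exact ⟨fun f hf x => ⟨rfl, (key f hf x).1⟩, fun f hf x => (key f hf x).2⟩

/-- For a convex function the subgradient inequality near `x` extends along the segment to any `y`;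
the segment stays in the ball even if `x` is on its boundary. -/
theorem IsSubgradient.congr {f g : LpBall p n → ℝ} (hg : IsConvex g) {x : LpBall p n}
    (h : f =ᶠ[𝓝 x] g) {G : Fin n → ℝ} (hG : IsSubgradient f x G) : IsSubgradient g x G := by
  intro y
  have hconv : Convex ℝ (Metric.closedBall (0 : PiLp p (fun _ : Fin n => ℝ)) 1) :=
    convex_closedBall 0 1
  let w : ℝ → PiLp p (fun _ : Fin n => ℝ) := fun t => (1 - t) • x.1 + t • y.1
  have hw : ∀ t ∈ Set.Icc (0 : ℝ) 1, w t ∈ Metric.closedBall (0 : PiLp p (fun _ : Fin n => ℝ)) 1 :=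
    fun t ht => hconv x.2 y.2 (by linarith [ht.2]) ht.1 (by ring)
  let z : Set.Icc (0 : ℝ) 1 → LpBall p n := fun t => ⟨w t.1, hw t.1 t.2⟩
  have hz : Continuous z := by
    refine Continuous.subtype_mk ?_ _
    simp only [w]
    fun_prop
  have hz0 : z 0 = x := by simp [z, w]
  have hev : ∀ᶠ t in 𝓝 (0 : Set.Icc (0 : ℝ) 1), f (z t) = g (z t) := by
    have := hz.continuousAt (x := 0)
    rw [ContinuousAt, hz0] at this
    exact this.eventually h
  -- The segment is parametrized by a subtype; the projection allows choosing a real parameter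
  -- strictly between `0` and `1`.
  have hproj : Tendsto (Set.projIcc (0 : ℝ) 1 zero_le_one) (𝓝[>] 0) (𝓝 0) := by
    have : Tendsto (Set.projIcc (0 : ℝ) 1 zero_le_one) (𝓝 0)
        (𝓝 (Set.projIcc (0 : ℝ) 1 zero_le_one 0)) := continuous_projIcc.continuousAt
    rw [Set.projIcc_left] at this
    exact this.mono_left nhdsWithin_le_nhds
  have hlt : ∀ᶠ t in 𝓝[>] (0 : ℝ), t < 1 :=
    eventually_nhdsWithin_of_eventually_nhds (eventually_lt_nhds one_pos)
  obtain ⟨t, ht, ht1, ht0⟩ :=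
    ((hproj.eventually hev).and (hlt.and (eventually_mem_nhdsWithin (a := (0 : ℝ))
      (s := Set.Ioi 0)))).exists
  have ht0 : 0 < t := ht0
  rw [Set.projIcc_of_mem zero_le_one ⟨ht0.le, ht1.le⟩] at ht
  have h1 := hG (z ⟨t, ht0.le, ht1.le⟩)
  rw [ht] at h1
  have h2 := hg x y (z ⟨t, ht0.le, ht1.le⟩) (1 - t) t (by linarith) ht0.le (by ring) rfl
  have h3 : ∑ i, G i * ((z ⟨t, ht0.le, ht1.le⟩).1 i - x.1 i) =
      t * ∑ i, G i * (y.1 i - x.1 i) := by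
    rw [Finset.mul_sum]
    refine Finset.sum_congr rfl fun i _ => ?_
    simp only [z, w, PiLp.add_apply, PiLp.smul_apply, smul_eq_mul]
    ring
  rw [h3, h.self_of_nhds] at h1
  refine le_of_mul_le_mul_left ?_ ht0
  linarith

theorem axisOracle_congr {f g : LpBall p n → ℝ} (hf : IsConvex f) (hg : IsConvex g)
    {x : LpBall p n} (h : f =ᶠ[𝓝 x] g) : axisOracle p n f x = axisOracle p n g x := by
  have : {G | IsSubgradient f x G} = {G | IsSubgradient g x G} :=
    Set.ext fun G => ⟨fun hG => hG.congr hg h, fun hG => hG.congr hf h.symm⟩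
  simp only [axisOracle, this, h.self_of_nhds]

/-! ### The hard family on the ball -/

section Family

open BinaryTree

variable {M : ℕ}

/-- The bits that belong to one coordinate. -/
def row (s : Fin n × Fin M → Bool) (i : Fin n) : Fin M → Bool := fun k => s (i, k)

variable {ρ : ℝ} {s t : Fin n × Fin M → Bool}

theorem sum_single_mul (i : Fin n) (l : ℝ) (v : Fin n → ℝ) :
    ∑ j, (Pi.single i l : Fin n → ℝ) j * v j = l * v i := by
  rw [Finset.sum_eq_single i (fun j _ hj => by simp [Pi.single_eq_of_ne hj]) (by simp)]
  simp

/-- The rank of a coordinate at a point: larger values come first, and then lesser coordinates. -/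
noncomputable def coordKey (s : Fin n × Fin M → Bool) (z : Fin n → ℝ) (i : Fin n) : ℝ ×ₗ Fin n :=
  toLex (-fn M (row s i) (z i), i)

/-- The first coordinate that attains the maximum. -/
def IsLeading (s : Fin n × Fin M → Bool) (z : Fin n → ℝ) (i : Fin n) : Prop :=
  ∀ j, coordKey s z i ≤ coordKey s z j

theorem IsLeading.fn_le {z : Fin n → ℝ} {i : Fin n} (h : IsLeading s z i) (j : Fin n) :
    fn M (row s j) (z j) ≤ fn M (row s i) (z i) := by
  have := h j
  rw [coordKey, coordKey, Prod.Lex.toLex_le_toLex] at this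
  rcases this with h | ⟨h, -⟩
  · exact (neg_lt_neg_iff.1 h).le
  · exact (neg_inj.1 h).ge

theorem IsLeading.le {z : Fin n → ℝ} {i : Fin n} (h : IsLeading s z i) {j : Fin n}
    (hj : fn M (row s i) (z i) ≤ fn M (row s j) (z j)) : i ≤ j := by
  have := h j
  rw [coordKey, coordKey, Prod.Lex.toLex_le_toLex] at this
  rcases this with h | h
  · simp only at h; linarith
  · exact h.2

variable [NeZero n]

/-- The maximum over the coordinates of scaled functions of a binary tree. -/
noncomputable def treeMax (p : ℝ≥0∞) [Fact (1 ≤ p)] (ρ : ℝ) (s : Fin n × Fin M → Bool) :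
    LpBall p n → ℝ := fun x =>
  Finset.univ.sup' Finset.univ_nonempty (fun i => fn M (row s i) (ρ * x.1 i)) / ρ

theorem le_treeMax (hρ : 0 < ρ) (x : LpBall p n) (i : Fin n) :
    fn M (row s i) (ρ * x.1 i) / ρ ≤ treeMax p ρ s x := by
  refine div_le_div_of_nonneg_right ?_ hρ.le
  exact Finset.le_sup' (fun i => fn M (row s i) (ρ * x.1 i)) (Finset.mem_univ i)

theorem treeMax_le_iff (hρ : 0 < ρ) (x : LpBall p n) (a : ℝ) :
    treeMax p ρ s x ≤ a ↔ ∀ i, fn M (row s i) (ρ * x.1 i) ≤ a * ρ := by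
  simp [treeMax, div_le_iff₀ hρ]

theorem treeMax_isConvex (hρ : 0 < ρ) : IsConvex (treeMax p ρ s) := by
  intro x y z a b ha hb hab hz
  rw [treeMax_le_iff hρ]
  intro i
  have e : ρ * z.1 i = a * (ρ * x.1 i) + b * (ρ * y.1 i) := by
    rw [hz, PiLp.add_apply, PiLp.smul_apply, PiLp.smul_apply, smul_eq_mul, smul_eq_mul]; ring
  rw [e]
  refine (fn_convex M _ ha hb hab).trans ?_
  have h1 := (div_le_iff₀ hρ).1 (le_treeMax (s := s) hρ x i)
  have h2 := (div_le_iff₀ hρ).1 (le_treeMax (s := s) hρ y i)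
  nlinarith [mul_le_mul_of_nonneg_left h1 ha, mul_le_mul_of_nonneg_left h2 hb]

theorem treeMax_lipschitzWith (hρ : 0 < ρ) : LipschitzWith 1 (treeMax p ρ s) := by
  refine LipschitzWith.of_le_add fun x y => ?_
  rw [treeMax_le_iff hρ]
  intro i
  have h1 := (div_le_iff₀ hρ).1 (le_treeMax (s := s) hρ y i)
  have h2 := (abs_le.1 (abs_fn_sub_le M (row s i) (ρ * x.1 i) (ρ * y.1 i))).2
  have h3 : |ρ * x.1 i - ρ * y.1 i| ≤ dist x y * ρ := by
    rw [← mul_sub, abs_mul, abs_of_pos hρ, mul_comm]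
    refine mul_le_mul_of_nonneg_right ?_ hρ.le
    have := PiLp.norm_apply_le (p := p) (x.1 - y.1) i
    rw [Subtype.dist_eq, dist_eq_norm]
    simpa using this
  linarith

theorem isSubgradient_single (hρ : 0 < ρ) {x : LpBall p n} {i : Fin n} {l : ℝ}
    (hx : treeMax p ρ s x = fn M (row s i) (ρ * x.1 i) / ρ)
    (hl : ∀ u, fn M (row s i) (ρ * x.1 i) + l * (u - ρ * x.1 i) ≤ fn M (row s i) u) :
    IsSubgradient (treeMax p ρ s) x (Pi.single i l) := by
  intro y
  rw [sum_single_mul i l fun i => y.1 i - x.1 i, hx]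
  refine le_trans (le_of_eq ?_) ((div_le_div_of_nonneg_right (hl (ρ * y.1 i)) hρ.le).trans
    (le_treeMax hρ y i))
  field_simp

theorem exists_isSubgradient_treeMax (hρ : 0 < ρ) (x : LpBall p n) :
    ∃ (i : Fin n) (l : ℝ), IsSubgradient (treeMax p ρ s) x (Pi.single i l) := by
  obtain ⟨i, -, hi⟩ := Finset.exists_mem_eq_sup' (Finset.univ_nonempty (α := Fin n))
    (fun i => fn M (row s i) (ρ * x.1 i))
  obtain ⟨l, hl⟩ := exists_subgradient_fn M (row s i) (ρ * x.1 i)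
  exact ⟨i, l, isSubgradient_single hρ (by rw [treeMax, hi]) hl⟩

/-- The ball contains the cube of radius `1 / ρ`. -/
def ContainsCube (p : ℝ≥0∞) [Fact (1 ≤ p)] (n : ℕ) (ρ : ℝ) : Prop :=
  ∀ z : Fin n → ℝ, (∀ i, |z i| ≤ 1) →
    WithLp.toLp p (fun i => z i / ρ) ∈ Metric.closedBall (0 : PiLp p (fun _ : Fin n => ℝ)) 1

theorem abs_argmin_le_one (b : Fin M → Bool) : |argmin M b| ≤ 1 := by
  linarith [abs_argmin_le M b, minVal_le M]

theorem exists_treeMax_le (hρ : 0 < ρ) (hc : ContainsCube p n ρ) (s : Fin n × Fin M → Bool) :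
    ∃ x : LpBall p n, treeMax p ρ s x ≤ minVal M / ρ := by
  refine ⟨⟨_, hc (fun i => argmin M (row s i)) fun i => abs_argmin_le_one _⟩, ?_⟩
  rw [treeMax_le_iff hρ]
  intro i
  simp only
  rw [mul_div_cancel₀ _ hρ.ne', fn_argmin, div_mul_cancel₀ _ hρ.ne']

theorem minVal_le_treeMax (hρ : 0 < ρ) (x : LpBall p n) : minVal M / ρ ≤ treeMax p ρ s x :=
  (div_le_div_of_nonneg_right (minVal_le_fn M (row s 0) (ρ * x.1 0)) hρ.le).trans
    (le_treeMax hρ x 0)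

theorem eq_of_treeMax_lt (hρ : 0 < ρ) {ε : ℝ} (hε : ρ * ε ≤ (1 / 16) ^ M / 2) {x : LpBall p n}
    (hs : treeMax p ρ s x < minVal M / ρ + ε) (ht : treeMax p ρ t x < minVal M / ρ + ε) :
    s = t := by
  have key : ∀ (r : Fin n × Fin M → Bool), treeMax p ρ r x < minVal M / ρ + ε →
      ∀ i, fn M (row r i) (ρ * x.1 i) < minVal M + ρ * ε := by
    intro r hr i
    have := (div_lt_iff₀ hρ).1 ((le_treeMax hρ x i).trans_lt hr)
    rwa [add_mul, div_mul_cancel₀ _ hρ.ne', mul_comm ε] at this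
  ext ⟨i, k⟩
  exact congrFun (eq_of_fn_lt M hε (key s hs i) (key t ht i)) k

theorem eq_of_isEpsMin (hρ : 0 < ρ) (hc : ContainsCube p n ρ) {ε : ℝ}
    (hε : ρ * ε ≤ (1 / 16) ^ M / 2) {x : LpBall p n}
    (hs : IsEpsMin ε (treeMax p ρ s) x) (ht : IsEpsMin ε (treeMax p ρ t) x) : s = t := by
  have key : ∀ r : Fin n × Fin M → Bool, ⨅ y, treeMax p ρ r y ≤ minVal M / ρ := fun r => by
    obtain ⟨y, hy⟩ := exists_treeMax_le hρ hc r
    exact (ciInf_le ⟨minVal M / ρ, by rintro _ ⟨z, rfl⟩; exact minVal_le_treeMax hρ z⟩ y).trans hy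
  unfold IsEpsMin at hs ht
  exact eq_of_treeMax_lt hρ hε (hs.trans_le (by linarith [key s]))
    (ht.trans_le (by linarith [key t]))

theorem treeMax_injective (hρ : 0 < ρ) (hc : ContainsCube p n ρ) :
    Function.Injective (treeMax p ρ : (Fin n × Fin M → Bool) → LpBall p n → ℝ) := by
  intro s t h
  obtain ⟨x, hx⟩ := exists_treeMax_le hρ hc s
  have h1 : 0 < ((1 : ℝ) / 16) ^ M / 2 / ρ := by positivity
  exact eq_of_treeMax_lt hρ (ε := (1 / 16) ^ M / 2 / ρ) (mul_div_cancel₀ _ hρ.ne').le (x := x)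
    (by linarith) (by rw [← h]; linarith)

/-- One coordinate beyond `1/2` makes the maximum equal to that of the absolute values, whatever the
string. -/
theorem treeMax_eventuallyEq (hρ : 0 < ρ) {x : LpBall p n} {i : Fin n}
    (hi : 1 / 2 < |ρ * x.1 i|) : treeMax p ρ s =ᶠ[𝓝 x] treeMax p ρ t := by
  have hcont : Continuous fun y : LpBall p n => |ρ * y.1 i| := by fun_prop
  have key : ∀ (r r' : Fin n × Fin M → Bool) (y : LpBall p n), 1 / 2 < |ρ * y.1 i| →
      treeMax p ρ r y ≤ treeMax p ρ r' y := by
    intro r r' y hy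
    rw [treeMax_le_iff hρ]
    intro j
    have h1 := (div_le_iff₀ hρ).1 (le_treeMax (s := r') hρ y j)
    have h2 := (div_le_iff₀ hρ).1 (le_treeMax (s := r') hρ y i)
    have h3 := abs_le_fn M (row r' j) (ρ * y.1 j)
    have h4 := abs_le_fn M (row r' i) (ρ * y.1 i)
    exact (fn_le M _ _).trans (max_le (h3.trans h1) (by linarith))
  filter_upwards [hcont.continuousAt.eventually_const_lt hi] with y hy
  exact le_antisymm (key s t y hy) (key t s y hy)

theorem IsLeading.treeMax_eq (hρ : 0 < ρ) {x : LpBall p n} {i : Fin n}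
    (h : IsLeading s (fun i => ρ * x.1 i) i) :
    treeMax p ρ s x = fn M (row s i) (ρ * x.1 i) / ρ := by
  refine le_antisymm ?_ (le_treeMax hρ x i)
  rw [treeMax_le_iff hρ]
  intro j
  rw [div_mul_cancel₀ _ hρ.ne']
  exact h.fn_le j

/-- A single-coordinate subgradient bounds the function of its coordinate from below wherever this
function is above the minimum. -/
theorem le_of_isSubgradient_single (hρ : 0 < ρ) (hc : ContainsCube p n ρ) {x : LpBall p n}
    {j : Fin n} {l : ℝ} (h : IsSubgradient (treeMax p ρ s) x (Pi.single j l)) {u : ℝ}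
    (hu : |u| ≤ 1) :
    ρ * treeMax p ρ s x + l * (u - ρ * x.1 j) ≤ max (fn M (row s j) u) (minVal M) := by
  -- The subgradient inequality is tested at the point with all other coordinates at their
  -- minimizers, so that only coordinate `j` can exceed the minimum.
  let z : Fin n → ℝ := Function.update (fun i => argmin M (row s i)) j u
  have hz : ∀ i, |z i| ≤ 1 := by
    intro i
    by_cases e : i = j
    · subst e; simpa [z] using hu
    · simpa [z, Function.update_of_ne e] using abs_argmin_le_one _
  have h1 := h ⟨_, hc z hz⟩
  rw [sum_single_mul j l fun i => _ - _] at h1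
  have h2 : treeMax p ρ s ⟨_, hc z hz⟩ ≤ max (fn M (row s j) u) (minVal M) / ρ := by
    rw [treeMax_le_iff hρ]
    intro i
    simp only
    rw [mul_div_cancel₀ _ hρ.ne', div_mul_cancel₀ _ hρ.ne']
    by_cases e : i = j
    · subst e; simp [z]
    · simp [z, Function.update_of_ne e, fn_argmin]
  have h3 := (le_div_iff₀ hρ).1 (h1.trans h2)
  refine le_trans (le_of_eq ?_) h3
  simp only [z, Function.update_self]
  field_simp

theorem fn_subgradient_of_eventually {b : Fin M → Bool} {v l : ℝ}
    (h : ∀ᶠ u in 𝓝 v, fn M b v + l * (u - v) ≤ fn M b u) (u : ℝ) :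
    fn M b v + l * (u - v) ≤ fn M b u := by
  have hc : Tendsto (fun τ : ℝ => (1 - τ) * v + τ * u) (𝓝[>] 0) (𝓝 v) := by
    have : Continuous fun τ : ℝ => (1 - τ) * v + τ * u := by fun_prop
    have := this.tendsto 0
    simp only [sub_zero, one_mul, zero_mul, add_zero] at this
    exact this.mono_left nhdsWithin_le_nhds
  have hlt : ∀ᶠ t in 𝓝[>] (0 : ℝ), t < 1 :=
    eventually_nhdsWithin_of_eventually_nhds (eventually_lt_nhds one_pos)
  obtain ⟨τ, h1, h2, h3⟩ := ((hc.eventually h).and (hlt.and (eventually_mem_nhdsWithin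
    (a := (0 : ℝ)) (s := Set.Ioi 0)))).exists
  have h3 : 0 < τ := h3
  have h4 := fn_convex M b (x := v) (y := u) (by linarith) h3.le (show 1 - τ + τ = 1 by ring)
  refine le_of_mul_le_mul_left ?_ h3
  have e : l * ((1 - τ) * v + τ * u - v) = τ * (l * (u - v)) := by ring
  rw [e] at h1
  linarith

/-- Above the minimum and in the interior of the cube, the subgradients on the least axis are those
of the function of the leading coordinate. -/
theorem isLeastSingle_iff (hρ : 0 < ρ) (hc : ContainsCube p n ρ) {x : LpBall p n} {i : Fin n}
    (hx : ∀ i, |ρ * x.1 i| < 1) (hi : IsLeading s (fun i => ρ * x.1 i) i)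
    (hmin : minVal M < fn M (row s i) (ρ * x.1 i)) (G : Fin n → ℝ) :
    IsLeastSingle {G | IsSubgradient (treeMax p ρ s) x G} G ↔ ∃ l, G = Pi.single i l ∧
      ∀ᶠ u in 𝓝 (ρ * x.1 i),
        fn M (row s i) (ρ * x.1 i) + l * (u - ρ * x.1 i) ≤ fn M (row s i) u := by
  have hval := hi.treeMax_eq hρ
  have hval' : ρ * treeMax p ρ s x = fn M (row s i) (ρ * x.1 i) := by
    rw [hval, mul_div_cancel₀ _ hρ.ne']
  have hleast : ∀ (j : Fin n) (l : ℝ), IsSubgradient (treeMax p ρ s) x (Pi.single j l) → i ≤ j := by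
    intro j l h
    have h1 := le_of_isSubgradient_single hρ hc h (hx j).le
    rw [hval', sub_self, mul_zero, add_zero] at h1
    exact hi.le ((le_max_iff.1 h1).resolve_right (not_le.2 hmin))
  constructor
  · rintro ⟨hG, j, l, rfl, hj⟩
    obtain ⟨l', hl'⟩ := exists_subgradient_fn M (row s i) (ρ * x.1 i)
    obtain rfl : j = i := le_antisymm (hj i l' (isSubgradient_single hρ hval hl')) (hleast j l hG)
    refine ⟨l, rfl, ?_⟩
    have h1 : ∀ᶠ u in 𝓝 (ρ * x.1 j), |u| < 1 :=
      continuous_abs.continuousAt.eventually_lt_const (hx j)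
    have h2 : ∀ᶠ u in 𝓝 (ρ * x.1 j),
        minVal M < fn M (row s j) (ρ * x.1 j) + l * (u - ρ * x.1 j) := by
      have : Continuous fun u => fn M (row s j) (ρ * x.1 j) + l * (u - ρ * x.1 j) := by fun_prop
      exact this.continuousAt.eventually_const_lt (by simpa using hmin)
    filter_upwards [h1, h2] with u hu1 hu2
    have h3 := le_of_isSubgradient_single hρ hc hG hu1.le
    rw [hval'] at h3
    exact (le_max_iff.1 h3).resolve_right (not_le.2 hu2)
  · rintro ⟨l, rfl, h⟩
    exact ⟨isSubgradient_single hρ hval (fn_subgradient_of_eventually h), i, l, rfl, hleast⟩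

/-- Locality is not enough, as other coordinates may tie with the leading one and differ nearby. But
`axisOracle` depends only on the value and the set of least-axis subgradients, which the germ of the
leading coordinate determines. At the minimum the strings coincide, and outside the open cube the
functions coincide locally. -/
theorem axisOracle_treeMax_eq (hρ : 0 < ρ) (hc : ContainsCube p n ρ) {x : LpBall p n} {i : Fin n}
    (hs : IsLeading s (fun i => ρ * x.1 i) i) (ht : IsLeading t (fun i => ρ * x.1 i) i)
    (h : fn M (row s i) =ᶠ[𝓝 (ρ * x.1 i)] fn M (row t i)) :
    axisOracle p n (treeMax p ρ s) x = axisOracle p n (treeMax p ρ t) x := by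
  by_cases hx : ∀ i, |ρ * x.1 i| < 1
  · have hv := h.self_of_nhds
    have e : treeMax p ρ s x = treeMax p ρ t x := by rw [hs.treeMax_eq hρ, ht.treeMax_eq hρ, hv]
    rcases (minVal_le_fn M (row s i) (ρ * x.1 i)).eq_or_lt with hm | hm
    · have h1 : 0 < ((1 : ℝ) / 16) ^ M / 2 / ρ := by positivity
      have h2 : treeMax p ρ s x = minVal M / ρ := by rw [hs.treeMax_eq hρ, ← hm]
      have : s = t := eq_of_treeMax_lt hρ (mul_div_cancel₀ _ hρ.ne').le (x := x)
        (show _ < _ + ((1 : ℝ) / 16) ^ M / 2 / ρ by linarith) (by rw [← e]; linarith)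
      rw [this]
    · have : IsLeastSingle {G | IsSubgradient (treeMax p ρ s) x G} =
          IsLeastSingle {G | IsSubgradient (treeMax p ρ t) x G} := by
        funext G
        rw [eq_iff_iff, isLeastSingle_iff hρ hc hx hs hm, isLeastSingle_iff hρ hc hx ht (hv ▸ hm)]
        refine exists_congr fun l => and_congr_right fun _ => eventually_congr ?_
        filter_upwards [h] with u hu
        rw [hv, hu]
      rw [axisOracle, axisOracle, this, e]
  · push Not at hx
    obtain ⟨j, hj⟩ := hx
    exact axisOracle_congr (treeMax_isConvex hρ) (treeMax_isConvex hρ)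
      (treeMax_eventuallyEq hρ (by linarith : 1 / 2 < |ρ * x.1 j|))

/-! ### The order in which a query compares the bits -/

/-- The string that leaves the path to `v` exactly at the place `k`. -/
noncomputable def leave (v : ℝ) (k : Fin M) : Fin M → Bool :=
  Function.update (path M v) k (!path M v k)

theorem leave_self (v : ℝ) (k : Fin M) : leave v k k ≠ path M v k := by simp [leave]

theorem leave_of_lt (v : ℝ) {j k : Fin M} (h : j < k) : leave v k j = path M v j := by
  simp [leave, Function.update_of_ne h.ne]

/-- The order in which the bits of the string are compared by a query. -/
noncomputable def bitKey (z : Fin n → ℝ) (b : Fin n × Fin M) : ℝ ×ₗ (Fin n ×ₗ Fin M) :=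
  toLex (-fn M (leave (z b.1) b.2) (z b.1), toLex b)

theorem exists_isLeading_of_isFirstMismatch {z : Fin n → ℝ} {b : Fin n × Fin M}
    (hs : IsFirstMismatch (bitKey z) (fun b => path M (z b.1) b.2) s b)
    (ht : IsFirstMismatch (bitKey z) (fun b => path M (z b.1) b.2) t b) :
    ∃ i, IsLeading s z i ∧ IsLeading t z i ∧ fn M (row s i) =ᶠ[𝓝 (z i)] fn M (row t i) := by
  obtain ⟨i, k⟩ := b
  have hpath : ∀ r : Fin n × Fin M → Bool,
      IsFirstMismatch (bitKey z) (fun b => path M (z b.1) b.2) r (i, k) →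
      ∀ l < k, row r i l = path M (z i) l := by
    intro r hr l hl
    refine hr.2 (i, l) ?_
    have h1 : fn M (leave (z i) k) (z i) ≤ fn M (leave (z i) l) (z i) :=
      fn_le_fn M (fun j hj => leave_of_lt _ hj) (leave_self _ _)
        fun j hj => leave_of_lt _ (hj.trans_lt hl)
    rw [bitKey, bitKey, Prod.Lex.toLex_lt_toLex]
    rcases h1.lt_or_eq with h | h
    · exact Or.inl (neg_lt_neg h)
    · exact Or.inr ⟨by simp only [h], Prod.Lex.toLex_lt_toLex.2 (Or.inr ⟨rfl, hl⟩)⟩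
  have hgerm : ∀ r : Fin n × Fin M → Bool,
      IsFirstMismatch (bitKey z) (fun b => path M (z b.1) b.2) r (i, k) →
      fn M (row r i) =ᶠ[𝓝 (z i)] fn M (leave (z i) k) := fun r hr =>
    fn_eventuallyEq M (hpath r hr) (fun j hj => leave_of_lt _ hj) hr.1 (leave_self _ _)
  have hkey : ∀ r : Fin n × Fin M → Bool,
      IsFirstMismatch (bitKey z) (fun b => path M (z b.1) b.2) r (i, k) →
      coordKey r z i = toLex (-fn M (leave (z i) k) (z i), i) := fun r hr => by
    rw [coordKey, (hgerm r hr).self_of_nhds]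
  -- Row `j` follows the path before `l`, so its value is at most that of leaving at `l`, which
  -- ranks no earlier than `(i, k)`.
  have hlater : ∀ r : Fin n × Fin M → Bool,
      IsFirstMismatch (bitKey z) (fun b => path M (z b.1) b.2) r (i, k) →
      ∀ (j : Fin n) (l : Fin M), bitKey z (i, k) ≤ bitKey z (j, l) →
      (∀ l' < l, bitKey z (j, l') < bitKey z (i, k)) → coordKey r z i ≤ coordKey r z j := by
    intro r hr j l hl hl'
    have h1 : fn M (row r j) (z j) ≤ fn M (leave (z j) l) (z j) := by
      by_cases e : row r j l = path M (z j) l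
      · refine fn_le_fn M (fun j hj => leave_of_lt _ hj) (leave_self _ _) fun l' h => ?_
        rcases h.eq_or_lt with rfl | h
        · exact e
        · exact hr.2 (j, l') (hl' l' h)
      · exact (fn_eventuallyEq M (fun l' h => hr.2 (j, l') (hl' l' h))
          (fun j hj => leave_of_lt _ hj) e (leave_self _ _)).self_of_nhds.le
    rw [hkey r hr, coordKey, Prod.Lex.toLex_le_toLex]
    rw [bitKey, bitKey, Prod.Lex.toLex_le_toLex] at hl
    simp only [Prod.Lex.toLex_le_toLex] at hl ⊢
    rcases hl with h | ⟨h, h2⟩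
    · exact Or.inl (by linarith)
    · rcases h1.lt_or_eq with h3 | h3
      · exact Or.inl (by linarith)
      · exact Or.inr ⟨by linarith, h2.elim le_of_lt fun h => h.1.le⟩
  -- Either all bits of row `j` precede the mismatch and equal the guess in both strings, or the
  -- first later bit shows that `j` does not outrank `i`.
  have hdich : ∀ j, row s j = row t j ∨
      coordKey s z i ≤ coordKey s z j ∧ coordKey t z i ≤ coordKey t z j := by
    intro j
    by_cases h : ∀ l, bitKey z (j, l) < bitKey z (i, k)
    · exact Or.inl (funext fun l => (hs.2 (j, l) (h l)).trans (ht.2 (j, l) (h l)).symm)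
    · push Not at h
      obtain ⟨l, hl, hmin⟩ := WellFounded.has_min (wellFounded_lt (α := Fin M))
        {l | bitKey z (i, k) ≤ bitKey z (j, l)} h
      replace hmin : ∀ l' < l, bitKey z (j, l') < bitKey z (i, k) := fun l' h' =>
        not_le.1 fun h2 => hmin l' h2 h'
      exact Or.inr ⟨hlater s hs j l hl hmin, hlater t ht j l hl hmin⟩
  obtain ⟨i₀, -, hi₀⟩ := Finset.exists_min_image Finset.univ (coordKey s z)
    (Finset.univ_nonempty (α := Fin n))
  have hi₀ : IsLeading s z i₀ := fun j => hi₀ j (Finset.mem_univ j)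
  have hst : coordKey s z i = coordKey t z i := (hkey s hs).trans (hkey t ht).symm
  have hcase : coordKey s z i₀ = coordKey t z i₀ ∧
      fn M (row s i₀) =ᶠ[𝓝 (z i₀)] fn M (row t i₀) := by
    rcases hdich i₀ with h | h
    · rw [coordKey, coordKey, h]; exact ⟨rfl, EventuallyEq.rfl⟩
    · have e : coordKey s z i₀ = coordKey s z i := le_antisymm (hi₀ i) h.1
      obtain rfl : i₀ = i := congrArg (fun y : ℝ ×ₗ Fin n => (ofLex y).2) e
      exact ⟨hst, (hgerm s hs).trans (hgerm t ht).symm⟩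
  refine ⟨i₀, hi₀, fun j => ?_, hcase.2⟩
  rw [← hcase.1]
  rcases hdich j with h | h
  · have : coordKey s z j = coordKey t z j := by rw [coordKey, coordKey, h]
    exact this ▸ hi₀ j
  · exact (hi₀ i).trans (hst.le.trans h.2)

open Classical in
/-- Few functions of the family are minimized with few queries. -/
theorem card_filter_treeMax_le (hρ : 0 < ρ) (hc : ContainsCube p n ρ) {ε : ℝ}
    (hε : ρ * ε ≤ (1 / 16) ^ M / 2)
    (A : Algorithm (LpBall p n) (ℝ × (Fin n → ℝ)) (LpBall p n)) (N : ℕ) :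
    ((Finset.univ.filter fun s : Fin n × Fin M → Bool =>
      ∃ o, A (A.answers (axisOracle p n (treeMax p ρ s)) N) = Sum.inr o ∧
        IsEpsMin ε (treeMax p ρ s) o).card : ℝ) ≤ 2 ^ N * (3 / 2) ^ (n * M) := by
  have := Algorithm.card_solved_le
    (key := fun (x : LpBall p n) (b : Fin n × Fin M) => bitKey (fun i => ρ * x.1 i) b)
    (g := fun x b => path M (ρ * x.1 b.1) b.2)
    (ans := fun s => axisOracle p n (treeMax p ρ s))
    (good := fun s => IsEpsMin ε (treeMax p ρ s))
    (fun x b s t hs ht => by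
      obtain ⟨i, h1, h2, h3⟩ := exists_isLeading_of_isFirstMismatch hs ht
      exact axisOracle_treeMax_eq hρ hc h1 h2 h3)
    (fun s t o hs ht => eq_of_isEpsMin hρ hc hε hs ht) A N Finset.univ fun _ => false
  simpa [subcube_univ] using this

end Family

end LpBall

/-! ### Averaging over the private randomness -/

namespace RandomizedAlgorithm

variable {I Q R O : Type} {F : Finset I} {orc : I → Q → R} {good : I → O → Prop}

open Classical in
/-- If no deterministic algorithm solves more than a fraction `η` of the instances with `N` queries,
then a randomized algorithm needs more queries with the probability of success, up to `η`. -/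
theorem successProb_le (A : RandomizedAlgorithm F orc good) (hF : F.Nonempty) {N : ℕ} {η : ℝ≥0∞}
    (h : ∀ D : Algorithm Q R O,
      ((F.filter fun f => ∃ o, D (D.answers (orc f) N) = Sum.inr o ∧ good f o).card : ℝ≥0∞) ≤
        η * F.card)
    {τ : ℝ≥0∞} (hτ : τ ≤ (N + 1 : ℕ)) : A.successProb ≤ A.tailProb τ + η := by
  let _ := A.mΩ
  have := A.isProb
  let S : I → Set A.Ω := fun f => {ω | ∃ o, (A.alg ω).Returns (orc f) o ∧ good f o}
  let W : I → Set A.Ω := fun f => {ω | τ ≤ ((A.alg ω).queryCount (orc f) : ℝ≥0∞)}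
  have hS : ∀ f ∈ F, MeasurableSet (S f) := A.measurableSet_success
  have hW : ∀ f ∈ F, MeasurableSet (W f) := fun f hf =>
    measurableSet_le measurable_const (A.measurable_queryCount f hf)
  -- Success with `T < τ` is success within `N` queries; for each outcome of the private randomness
  -- the deterministic bound applies.
  have hearly : ∑ f ∈ F, A.μ (S f \ W f) ≤ η * F.card := by
    calc ∑ f ∈ F, A.μ (S f \ W f)
        = ∑ f ∈ F, ∫⁻ ω, (S f \ W f).indicator 1 ω ∂A.μ :=
          Finset.sum_congr rfl fun f hf => (lintegral_indicator_one ((hS f hf).diff (hW f hf))).symm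
      _ = ∫⁻ ω, ∑ f ∈ F, (S f \ W f).indicator 1 ω ∂A.μ :=
          (lintegral_finsetSum F fun f hf =>
            measurable_one.indicator ((hS f hf).diff (hW f hf))).symm
      _ ≤ ∫⁻ _, η * F.card ∂A.μ := by
          refine lintegral_mono fun ω => le_trans ?_ (h (A.alg ω))
          rw [Finset.card_filter, Nat.cast_sum]
          refine Finset.sum_le_sum fun f hf => ?_
          by_cases hω : ω ∈ S f \ W f
          · obtain ⟨⟨o, ho, hgood⟩, hlt⟩ := hω
            have hlt : ((A.alg ω).queryCount (orc f) : ℝ≥0∞) < (N + 1 : ℕ) :=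
              (not_le.1 hlt).trans_le hτ
            have hlt' : (A.alg ω).queryCount (orc f) < ((N + 1 : ℕ) : ℕ∞) := by
              rw [← ENat.toENNReal_lt]; simpa using hlt
            rw [if_pos ⟨o, Algorithm.apply_answers_of_returns ho hlt', hgood⟩, Nat.cast_one]
            exact Set.indicator_le_self' (f := (1 : A.Ω → ℝ≥0∞)) (fun _ _ => zero_le) ω
          · rw [Set.indicator_of_notMem hω]; exact zero_le
      _ = η * F.card := by simp
  have hsum : ∑ f ∈ F, A.μ (S f) ≤ ∑ f ∈ F, A.μ (W f) + η * F.card := by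
    refine le_trans ?_ (add_le_add le_rfl hearly)
    rw [← Finset.sum_add_distrib]
    refine Finset.sum_le_sum fun f _ => ?_
    exact (measure_mono (by rw [Set.union_sdiff_self]; exact Set.subset_union_right)).trans
      (measure_union_le (W f) (S f \ W f))
  have h0 : (F.card : ℝ≥0∞) ≠ 0 := by simpa using hF.ne_empty
  refine (ENNReal.div_le_div_right hsum _).trans (le_of_eq ?_)
  rw [ENNReal.add_div, ENNReal.mul_div_cancel_right h0 (ENNReal.natCast_ne_top _)]
  rfl

/-- Markov's inequality on each instance. -/
theorem mul_tailProb_le (A : RandomizedAlgorithm F orc good) (τ : ℝ≥0∞) :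
    τ * A.tailProb τ ≤ A.expectedQueries := by
  let _ := A.mΩ
  rw [tailProb, expectedQueries, ← mul_div_assoc, Finset.mul_sum]
  refine ENNReal.div_le_div_right (Finset.sum_le_sum fun f hf => ?_) _
  exact mul_meas_ge_le_lintegral (A.measurable_queryCount f hf) τ

end RandomizedAlgorithm

/-! ### Choice of the parameters -/

namespace LpBall

theorem containsCube_rpow {p : ℝ≥0∞} [Fact (1 ≤ p)] (hp : p ≠ ⊤) {n : ℕ} (hn : 1 ≤ n) :
    ContainsCube p n ((n : ℝ) ^ (1 / p.toReal)) := by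
  intro z hz
  have hp1 : 1 ≤ p.toReal := by
    have := ENNReal.toReal_mono hp (Fact.out : 1 ≤ p)
    simpa using this
  have hp0 : 0 < p.toReal := by linarith
  have hn0 : (0 : ℝ) < n := by exact_mod_cast hn
  have hρ : 0 < (n : ℝ) ^ (1 / p.toReal) := Real.rpow_pos_of_pos hn0 _
  rw [mem_closedBall_zero_iff, PiLp.norm_eq_sum hp0]
  refine Real.rpow_le_one (by positivity) ?_ (by positivity)
  have key : ∀ i, ‖z i / (n : ℝ) ^ (1 / p.toReal)‖ ^ p.toReal ≤ 1 / n := by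
    intro i
    rw [norm_div, Real.norm_of_nonneg hρ.le, Real.div_rpow (norm_nonneg _) hρ.le,
      ← Real.rpow_mul hn0.le, one_div_mul_cancel hp0.ne', Real.rpow_one]
    exact div_le_div_of_nonneg_right (Real.rpow_le_one (norm_nonneg _) (hz i) hp0.le) hn0.le
  refine (Finset.sum_le_sum fun i _ => key i).trans ?_
  simp [hn0.ne']

/-- Rescaling the cube in the ball to the unit cube keeps a fraction of the bits of accuracy. -/
theorem rpow_mul_le {δ : ℝ} (hδ : 0 < δ) {P : ℝ} (hP : 1 ≤ P) {n : ℕ} (hn : 1 ≤ n) {ε : ℝ}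
    (hε : 0 < ε) (h : ε ≤ (n : ℝ) ^ (-(1 / P) - δ)) :
    δ * Real.logb 2 n ≤ Real.logb 2 (1 / ε) ∧
      (n : ℝ) ^ (1 / P) * ε ≤ 2 ^ (-(δ / (1 + δ) * Real.logb 2 (1 / ε))) := by
  have hn0 : (0 : ℝ) < n := by exact_mod_cast hn
  have ha : 0 ≤ Real.logb 2 n := Real.logb_nonneg (by norm_num) (by exact_mod_cast hn)
  have h1 : Real.logb 2 ε ≤ (-(1 / P) - δ) * Real.logb 2 n := by
    rw [← Real.logb_rpow_eq_mul_logb_of_pos hn0]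
    exact Real.logb_le_logb_of_le (by norm_num) hε h
  have hl : Real.logb 2 (1 / ε) = -Real.logb 2 ε := by rw [one_div, Real.logb_inv]
  have hP0 : 0 ≤ 1 / P := by positivity
  have hP1 : 1 / P ≤ 1 := by rw [div_le_one (by linarith)]; exact hP
  rw [hl]
  refine ⟨by nlinarith [mul_nonneg hP0 ha], ?_⟩
  rw [← Real.logb_le_iff_le_rpow (by norm_num) (by positivity),
    Real.logb_mul (by positivity) hε.ne', Real.logb_rpow_eq_mul_logb_of_pos hn0]
  -- Here `1 / P ≤ 1` is used, which makes the exponent `δ / (1 + δ)` independent of `p`.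
  have h2 : 1 / P * Real.logb 2 n * (1 + δ) ≤ (1 / P + δ) * Real.logb 2 n := by
    nlinarith [mul_nonneg (mul_nonneg hδ.le (sub_nonneg.2 hP1)) ha]
  have h3 : 1 / P * Real.logb 2 n ≤ -Real.logb 2 ε / (1 + δ) := by
    rw [le_div_iff₀ (by linarith)]
    linarith
  have h4 : -Real.logb 2 ε / (1 + δ) = -Real.logb 2 ε - δ / (1 + δ) * -Real.logb 2 ε := by
    field_simp; ring
  linarith

theorem one_div_sixteen_pow_div_two (M : ℕ) :
    ((1 : ℝ) / 16) ^ M / 2 = 2 ^ (-(4 * M + 1) : ℝ) := by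
  rw [Real.rpow_neg (by norm_num), Real.rpow_add (by norm_num), Real.rpow_mul (by norm_num),
    Real.rpow_natCast, Real.rpow_one, one_div_pow, show (2 : ℝ) ^ (4 : ℝ) = 16 by norm_num,
    mul_inv, one_div, div_eq_mul_inv]

/-- The factor `8` is large enough that `2 * (3/4)^8 ≤ exp (-1)`; then `exp (-y) ≤ 1 / y`. -/
theorem two_pow_mul_le {y : ℝ} (hy : 0 < y) {N L : ℕ} (hN : N ≤ y) (hL : 8 * y ≤ L) :
    (2 : ℝ) ^ N * (3 / 2) ^ L ≤ 1 / y * 2 ^ L := by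
  have h1 : (2 : ℝ) ^ N ≤ 2 ^ y := by
    rw [← Real.rpow_natCast]; exact Real.rpow_le_rpow_of_exponent_le (by norm_num) hN
  have h2 : ((3 : ℝ) / 4) ^ L ≤ (6561 / 65536) ^ y := by
    rw [← Real.rpow_natCast, show (6561 / 65536 : ℝ) = (3 / 4) ^ (8 : ℝ) by norm_num,
      ← Real.rpow_mul (by norm_num)]
    exact Real.rpow_le_rpow_of_exponent_ge (by norm_num) (by norm_num) hL
  have h3 : (2 : ℝ) ^ y * (6561 / 65536) ^ y ≤ Real.exp (-y) := by
    rw [← Real.mul_rpow (by norm_num) (by norm_num), neg_eq_neg_one_mul y, Real.exp_mul]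
    refine Real.rpow_le_rpow (by norm_num) ?_ hy.le
    rw [Real.exp_neg, le_inv_comm₀ (by norm_num) (Real.exp_pos 1)]
    have := Real.exp_one_lt_d9
    norm_num at this ⊢
    linarith
  have h4 : Real.exp (-y) ≤ 1 / y := by
    rw [Real.exp_neg, one_div]
    exact inv_anti₀ hy (by linarith [Real.add_one_le_exp y])
  have h5 : ((3 : ℝ) / 2) ^ L = (3 / 4) ^ L * 2 ^ L := by rw [← mul_pow]; norm_num
  rw [h5, ← mul_assoc]
  refine mul_le_mul_of_nonneg_right ?_ (by positivity)
  exact (mul_le_mul h1 h2 (by positivity) (by positivity)).trans (h3.trans h4)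

open Classical in
/-- Success with few queries is unlikely on the hard family. -/
theorem successProb_treeMax_le {p : ℝ≥0∞} [Fact (1 ≤ p)] {n M : ℕ} [NeZero n] {ρ ε y : ℝ}
    (hρ : 0 < ρ) (hc : ContainsCube p n ρ) (hε : ρ * ε ≤ (1 / 16) ^ M / 2) (hy : 0 < y)
    (hL : 8 * y ≤ n * M)
    (A : RandomizedAlgorithm (Finset.univ.image (treeMax p ρ : (Fin n × Fin M → Bool) → _))
      (axisOracle p n) (IsEpsMin ε)) :
    A.successProb ≤ A.tailProb (ENNReal.ofReal y) + ENNReal.ofReal (1 / y) := by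
  have hinj : Function.Injective (treeMax p ρ : (Fin n × Fin M → Bool) → LpBall p n → ℝ) :=
    treeMax_injective hρ hc
  refine A.successProb_le (Finset.univ_nonempty.image _) (N := ⌊y⌋₊) (fun D => ?_) ?_
  · rw [Finset.filter_image, Finset.card_image_of_injective _ hinj,
      Finset.card_image_of_injective _ hinj, ← ENNReal.ofReal_natCast, ← ENNReal.ofReal_natCast,
      ← ENNReal.ofReal_mul (by positivity)]
    refine ENNReal.ofReal_le_ofReal ((card_filter_treeMax_le hρ hc hε D ⌊y⌋₊).trans ?_)
    refine (two_pow_mul_le hy (Nat.floor_le hy.le) (L := n * M) (by push_cast; exact hL)).trans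
      (le_of_eq ?_)
    simp
  · rw [← ENNReal.ofReal_natCast]
    exact ENNReal.ofReal_le_ofReal (by push_cast; exact (Nat.lt_floor_add_one y).le)

end LpBall

/-! ### Assembling the two lower bounds -/

open LpBall in
theorem proposition5p4 (δ : ℝ) (hδ : 0 < δ) :
    ∃ (c K : ℝ) (η : ℝ → ℝ), 0 < c ∧ 0 < K ∧ Tendsto η atTop (𝓝 0) ∧
      ∀ (p : ℝ≥0∞) [Fact (1 ≤ p)], p ≠ ⊤ →
      ∀ (n : ℕ) (ε : ℝ), 1 ≤ n → 0 < ε → ε ≤ (n : ℝ) ^ (-(1 / p.toReal) - δ) →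
      ∃ (F : Finset (LpBall p n → ℝ)) (orc : LpBall.Oracle p n),
        F.Nonempty ∧
        (∀ f ∈ F, LpBall.IsConvex f ∧ LipschitzWith 1 f) ∧
        orc.IsSingleCoordinate F ∧
        orc.IsLocal F ∧
        ∀ Pe : ℝ, 0 ≤ Pe → Pe < 1 →
          (K ≤ (1 - Pe) * (n * Real.logb 2 (1 / ε)) →
            ENNReal.ofReal (c * ((1 - Pe) * (n * Real.logb 2 (1 / ε)))) ≤
              distributionalComplexity F orc (LpBall.IsEpsMin ε) Pe) ∧
          ENNReal.ofReal (c * (n * Real.logb 2 (1 / ε))) ≤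
            highProbabilityComplexity F orc (LpBall.IsEpsMin ε) Pe
              (η (n * Real.logb 2 (1 / ε))) := by
  classical
  set κ : ℝ := δ / (1 + δ) with hκdef
  have hκ : 0 < κ := by positivity
  -- `κ * ℓ ≥ 10` is what makes `M ≥ κ * ℓ / 8` despite the rounding in `M`.
  set ℓ₀ : ℝ := 10 / κ with hℓ₀def
  have hℓ₀ : 0 < ℓ₀ := by positivity
  -- If `ℓ < ℓ₀`, then `δ * log n ≤ ℓ` bounds `n` and forces `n * ℓ < t₀`. Below `t₀` the slack `2`
  -- makes the tail condition void.
  set t₀ : ℝ := 2 ^ (ℓ₀ / δ) * ℓ₀ with ht₀def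
  have ht₀ : 0 < t₀ := by positivity
  refine ⟨κ / 128, max t₀ (128 / κ), fun t => if t < t₀ then 2 else 1 / (κ * t / 64),
    by positivity, lt_max_of_lt_left ht₀, ?_, ?_⟩
  · have h1 : Tendsto (fun t : ℝ => 1 / (κ * t / 64)) atTop (𝓝 0) := by
      refine Tendsto.const_div_atTop ?_ 1
      exact (tendsto_id.const_mul_atTop hκ).atTop_div_const (by norm_num)
    refine h1.congr' ?_
    filter_upwards [eventually_ge_atTop t₀] with t ht
    rw [if_neg (not_lt.2 ht)]
  intro p _ hp n ε hn hε hεn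
  have : NeZero n := ⟨by omega⟩
  have hn0 : (0 : ℝ) < n := by exact_mod_cast hn
  have hP : 1 ≤ p.toReal := by
    have := ENNReal.toReal_mono hp (Fact.out : 1 ≤ p)
    simpa using this
  obtain ⟨hlog, hacc⟩ := rpow_mul_le hδ hP hn hε hεn
  have hlog0 : 0 ≤ Real.logb 2 n := Real.logb_nonneg (by norm_num) (by exact_mod_cast hn)
  set ℓ := Real.logb 2 (1 / ε) with hℓdef
  have hℓ : 0 ≤ ℓ := le_trans (by positivity) hlog
  set ρ : ℝ := (n : ℝ) ^ (1 / p.toReal)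
  have hρ : 0 < ρ := Real.rpow_pos_of_pos hn0 _
  have hc : ContainsCube p n ρ := containsCube_rpow hp hn
  -- Chosen so that `4 * M + 1 ≤ κ * ℓ`, the accuracy needed to read off all the bits.
  set M : ℕ := ⌊(κ * ℓ - 1) / 4⌋₊
  have hconv : ∀ f ∈ Finset.univ.image (treeMax p ρ : (Fin n × Fin M → Bool) → _),
      LpBall.IsConvex f ∧ LipschitzWith 1 f := by
    intro f hf
    obtain ⟨s, -, rfl⟩ := Finset.mem_image.1 hf
    exact ⟨treeMax_isConvex hρ, treeMax_lipschitzWith hρ⟩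
  refine ⟨Finset.univ.image (treeMax p ρ : (Fin n × Fin M → Bool) → _), axisOracle p n,
    Finset.univ_nonempty.image _, hconv, axisOracle_isSingleCoordinate fun f hf x => ?_,
    fun f hf g hg x h => axisOracle_congr (hconv f hf).1 (hconv g hg).1 h, ?_⟩
  · obtain ⟨s, -, rfl⟩ := Finset.mem_image.1 hf
    exact exists_isSubgradient_treeMax hρ x
  have htail : t₀ ≤ n * ℓ → ∀ A : RandomizedAlgorithm
      (Finset.univ.image (treeMax p ρ : (Fin n × Fin M → Bool) → _)) (axisOracle p n) (IsEpsMin ε),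
      A.successProb ≤ A.tailProb (ENNReal.ofReal (κ * (n * ℓ) / 64)) +
        ENNReal.ofReal (1 / (κ * (n * ℓ) / 64)) := by
    intro ht A
    have hℓℓ₀ : ℓ₀ ≤ ℓ := by
      by_contra! hlt
      have h1 : Real.logb 2 n ≤ ℓ₀ / δ := by
        rw [le_div_iff₀ hδ]
        linarith
      have h2 : (n : ℝ) ≤ 2 ^ (ℓ₀ / δ) := (Real.logb_le_iff_le_rpow (by norm_num) hn0).1 h1
      have h3 : (n : ℝ) * ℓ < n * ℓ₀ := mul_lt_mul_of_pos_left hlt hn0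
      have h4 : (n : ℝ) * ℓ₀ ≤ 2 ^ (ℓ₀ / δ) * ℓ₀ := mul_le_mul_of_nonneg_right h2 hℓ₀.le
      linarith
    have hκℓ : 10 ≤ κ * ℓ := by
      rw [hℓ₀def, div_le_iff₀ hκ] at hℓℓ₀
      linarith
    have hM : (M : ℝ) ≤ (κ * ℓ - 1) / 4 := Nat.floor_le (by linarith)
    have hM' : (κ * ℓ - 1) / 4 < M + 1 := Nat.lt_floor_add_one _
    refine successProb_treeMax_le hρ hc (hacc.trans ?_)
      (by have := ht₀.trans_le ht; positivity) ?_ A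
    · rw [one_div_sixteen_pow_div_two]
      exact Real.rpow_le_rpow_of_exponent_le (by norm_num) (by linarith)
    · have : κ * ℓ / 8 ≤ M := by linarith
      have := mul_le_mul_of_nonneg_left this hn0.le
      linarith
  intro Pe hPe hPe1
  have hPe' : 0 < 1 - Pe := by linarith
  have hlow : t₀ ≤ n * ℓ → ∀ A : RandomizedAlgorithm
      (Finset.univ.image (treeMax p ρ : (Fin n × Fin M → Bool) → _)) (axisOracle p n) (IsEpsMin ε),
      ENNReal.ofReal (1 - Pe) ≤ A.successProb →
      ENNReal.ofReal (1 - Pe - 1 / (κ * (n * ℓ) / 64)) ≤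
        A.tailProb (ENNReal.ofReal (κ * (n * ℓ) / 64)) := by
    intro ht A hA
    rw [ENNReal.ofReal_sub _ (by positivity), tsub_le_iff_right]
    exact hA.trans (htail ht A)
  refine ⟨fun hK => ?_, ?_⟩
  · have hnl : 0 ≤ n * ℓ := by positivity
    have hK1 : t₀ ≤ n * ℓ := ((le_max_left _ _).trans hK).trans (by nlinarith)
    have hK2 : 128 / κ ≤ (1 - Pe) * (n * ℓ) := (le_max_right _ _).trans hK
    have hpos : 0 < n * ℓ := ht₀.trans_le hK1
    refine le_iInf₂ fun A hA => le_trans ?_ (A.mul_tailProb_le (ENNReal.ofReal (κ * (n * ℓ) / 64)))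
    refine le_trans ?_ (mul_le_mul_right (hlow hK1 A hA) _)
    rw [← ENNReal.ofReal_mul (by positivity)]
    refine ENNReal.ofReal_le_ofReal ?_
    rw [div_le_iff₀ hκ] at hK2
    -- The subtracted `1` costs at most half, because `hK2` makes `κ * (n * ℓ) / 64 * (1 - Pe)` at
    -- least `2`; hence `c = κ / 128`.
    have e : κ * (n * ℓ) / 64 * (1 - Pe - 1 / (κ * (n * ℓ) / 64)) =
        κ * (n * ℓ) / 64 * (1 - Pe) - 1 := by
      rw [mul_sub, mul_one_div_cancel (by positivity)]
    rw [e]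
    linarith
  · refine le_iInf₂ fun A hA => ?_
    by_cases ht : n * ℓ < t₀
    · refine le_sSup ?_
      simp only [Set.mem_ofPred_eq, if_pos ht]
      rw [ENNReal.ofReal_of_nonpos (by linarith)]
      exact zero_le
    · refine le_sSup_of_le (b := ENNReal.ofReal (κ * (n * ℓ) / 64)) ?_ ?_
      · simp only [Set.mem_ofPred_eq, if_neg ht]
        exact hlow (not_lt.1 ht) A hA
      · refine ENNReal.ofReal_le_ofReal ?_
        have : 0 ≤ κ * (n * ℓ) := by positivity
        linarith
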